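/- For a finite simple undirected graph $G$ with at least one vertex, let $A(G)$ be its adjacency matrix, $D(G)$ its diagonal degree matrix, and, for $\alpha\in[0,1]$, put $A_\alpha(G)=\alpha D(G)+(1-\alpha)A(G)$; let $\rho_\alpha(G)$ be the largest eigenvalue of $A_\alpha(G)$. A real number $\lambda$ is an $A_\alpha$-limit point if there is a sequence $(G_k)$ of such graphs with $\rho_\alpha(G_i)\neq\rho_\alpha(G_j)$ for $i\neq j$ and $\lim_{k\to\infty}\rho_\alpha(G_k)=\lambda$. Let $0\le\alpha<1-\frac{2\sqrt5}{5}=0.10557\ldots$. Then the equation $$3\alpha-\lambda-\frac{(1-\alpha)^2}{\alpha-\lambda}-2\theta'_\alpha(\lambda)=0,\qquad \theta'_\alpha(\lambda)=\frac{(2\alpha-\lambda)+\sqrt{(2\alpha-\lambda)^2-4(1-\alpha)^2}}{2},$$ has exactly one solution $\lambda>2$, denoted $\tau_0(\alpha)$, and every real number $\lambda\ge\tau_0(\alpha)$ is an $A_\alpha$-limit point. -/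

import Mathlib

open Filter Topology

/-- The matrix `A_α(G) = α D(G) + (1 - α) A(G)` of a finite simple graph `G`. -/
noncomputable def alphaMatrix {V : Type*} [Fintype V] [DecidableEq V] (α : ℝ)
    (G : SimpleGraph V) [DecidableRel G.Adj] : Matrix V V ℝ :=
  α • G.degMatrix ℝ + (1 - α) • G.adjMatrix ℝ

/-- The `A_α`-spectral radius of `G`: the largest eigenvalue of `A_α(G)`. The supremum is a
maximum whenever `G` has a vertex, see `isGreatest_alphaSpectralRadius`. -/
noncomputable def alphaSpectralRadius {V : Type*} [Fintype V] [DecidableEq V] (α : ℝ)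
    (G : SimpleGraph V) [DecidableRel G.Adj] : ℝ :=
  sSup {μ : ℝ | Module.End.HasEigenvalue (Matrix.toLin' (alphaMatrix α G)) μ}

theorem isGreatest_alphaSpectralRadius {V : Type*} [Fintype V] [DecidableEq V] [Nonempty V]
    (α : ℝ) (G : SimpleGraph V) [DecidableRel G.Adj] :
    IsGreatest {μ : ℝ | Module.End.HasEigenvalue (Matrix.toLin' (alphaMatrix α G)) μ}
      (alphaSpectralRadius α G) := by
  have hH : (alphaMatrix α G).IsHermitian := by
    have h : (alphaMatrix α G).transpose = alphaMatrix α G := by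
      simp [alphaMatrix, SimpleGraph.degMatrix]
    rw [Matrix.IsHermitian, Matrix.conjTranspose_eq_transpose_of_trivial, h]
  have hfin : {μ : ℝ |
      Module.End.HasEigenvalue (Matrix.toLin' (alphaMatrix α G)) μ}.Finite :=
    Module.End.finite_hasEigenvalue _
  refine hfin.isCompact.isGreatest_sSup ?_
  obtain ⟨v⟩ := ‹Nonempty V›
  refine ⟨hH.eigenvalues v, ?_⟩
  have hs := hH.eigenvalues_mem_spectrum_real v
  rw [← Matrix.spectrum_toLin'] at hs
  exact Module.End.hasEigenvalue_iff_mem_spectrum.2 hs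

open Classical in
/-- `x` is an `A_α`-limit point: the limit of the `A_α`-spectral radii of a sequence of finite
(nonempty, simple, undirected) graphs whose `A_α`-spectral radii are pairwise distinct. -/
def IsAlphaLimitPoint (α x : ℝ) : Prop :=
  ∃ (n : ℕ → ℕ) (G : ∀ k, SimpleGraph (Fin (n k + 1))),
    (∀ i j, i ≠ j → alphaSpectralRadius α (G i) ≠ alphaSpectralRadius α (G j)) ∧
    Tendsto (fun k => alphaSpectralRadius α (G k)) atTop (𝓝 x)

/-- `θ'_α`, the larger fixed point of `t ↦ 2α - x - (1 - α)² / t`. -/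
noncomputable def thetaPrime (α x : ℝ) : ℝ :=
  ((2 * α - x) + √((2 * α - x) ^ 2 - 4 * (1 - α) ^ 2)) / 2

/-- `F₀(x, α) = 3α - x - (1 - α)² / (α - x) - 2 θ'_α`. -/
noncomputable def F₀ (x α : ℝ) : ℝ :=
  3 * α - x - (1 - α) ^ 2 / (α - x) - 2 * thetaPrime α x

/-- `τ₀(α)`, the solution `x > 2` of `F₀(x, α) = 0` (it exists and is unique for every
`α ∈ [0, 1]`). -/
noncomputable def tau₀ (α : ℝ) : ℝ :=
  sInf {x : ℝ | 2 < x ∧ F₀ x α = 0}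

/-!
It suffices that the spectral radii are dense in `(τ₀(α), ∞)`: every `λ ≥ τ₀(α)` is then the limit
of a strictly decreasing sequence of them. Given `t > τ₀(α)`, that is `t > 2` and `F₀ t α < 0`,
grow a caterpillar along its spine together with a positive vector `x` solving `A_α x = t x` except
at the last spine vertex, where the ratio `q` of `1 - α` times the next spine entry to the current
one is left free. Prolonging the spine acts by `q ↦ t - 2α - (1 - α)² / q`, which has the fixed
points `m = -θ'_α(t)` and `M = (1 - α)² / m`; a pendant leaf lowers `q` by the constant
`c = α + (1 - α)² / (t - α)`. Attaching leaves greedily keeps `q` in `[m, m + c)`, and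
`F₀ t α < 0` says precisely that `m + c < M`.

By the Rayleigh quotient the spectral radius tends to `t` provided the spine entries `x_k` stay
bounded. The energy `x_k² (q_k - m) (M - q_k)` is conserved when the spine is prolonged and, if
`c ≤ m`, it is not increased by greedy leaves; this bounds `x_k` whenever `q_k > 1 - α`, and the
`x_k` do not grow when `q_k ≤ 1 - α`. If `c > m`, the restriction on `α` forces
`m + c ≤ 1 - α`, so that they never grow.
-/

section Matrix

variable {ι : Type*} [Fintype ι] [DecidableEq ι] {A : Matrix ι ι ℝ} {t : ℝ}

theorem hasEigenvalue_le_of_mulVec_le (hA : ∀ i j, 0 ≤ A i j) {y : ι → ℝ} (hy : ∀ i, 0 < y i)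
    (hAy : ∀ i, (A.mulVec y) i ≤ t * y i) {μ : ℝ}
    (hμ : Module.End.HasEigenvalue (Matrix.toLin' A) μ) : μ ≤ t := by
  obtain ⟨z, hz⟩ := hμ.exists_hasEigenvector
  obtain ⟨j, hj⟩ : ∃ j, z j ≠ 0 := Function.ne_iff.1 hz.2
  have hAz : ∀ i, (A.mulVec z) i = μ * z i := congrFun hz.apply_eq_smul
  obtain ⟨i, -, hi⟩ := Finset.univ.exists_max_image (fun i => |z i| / y i) ⟨j, Finset.mem_univ j⟩
  set B := |z i| / y i
  have hzB : ∀ k, |z k| ≤ B * y k := fun k => (div_le_iff₀ (hy k)).1 (hi k (Finset.mem_univ k))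
  have hB : 0 < B := (div_pos (abs_pos.2 hj) (hy j)).trans_le (hi j (Finset.mem_univ j))
  have hBi : B * y i = |z i| := div_mul_cancel₀ _ (hy i).ne'
  refine le_of_mul_le_mul_right ?_ (mul_pos hB (hy i))
  calc μ * (B * y i) = μ * |z i| := by rw [hBi]
    _ ≤ |μ * z i| := by rw [abs_mul]; gcongr; exact le_abs_self μ
    _ = |∑ k, A i k * z k| := by rw [← hAz]; rfl
    _ ≤ ∑ k, |A i k * z k| := Finset.abs_sum_le_sum_abs _ _
    _ ≤ ∑ k, A i k * (B * y k) := by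
        gcongr with k
        rw [abs_mul, abs_of_nonneg (hA i k)]
        exact mul_le_mul_of_nonneg_left (hzB k) (hA i k)
    _ = B * (A.mulVec y) i := by
        simp only [Matrix.mulVec, dotProduct, Finset.mul_sum, mul_left_comm]
    _ ≤ B * (t * y i) := by gcongr; exact hAy i
    _ = t * (B * y i) := mul_left_comm _ _ _

theorem dotProduct_mulVec_le_of_hasEigenvalue_le (hA : A.IsHermitian)
    (ht : ∀ μ, Module.End.HasEigenvalue (Matrix.toLin' A) μ → μ ≤ t) (y : ι → ℝ) :
    y ⬝ᵥ A.mulVec y ≤ t * (y ⬝ᵥ y) := by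
  have hpsd : (algebraMap ℝ (Matrix ι ι ℝ) t - A).PosSemidef := by
    refine Matrix.posSemidef_iff_isHermitian_and_spectrum_nonneg.2 ⟨?_, ?_⟩
    · exact .sub (by simp [Matrix.IsHermitian, Matrix.algebraMap_eq_diagonal]) hA
    · rw [← spectrum.singleton_sub_eq, Set.singleton_sub]
      rintro _ ⟨μ, hμ, rfl⟩
      rw [← Matrix.spectrum_toLin', ← Module.End.hasEigenvalue_iff_mem_spectrum] at hμ
      exact sub_nonneg.2 (ht μ hμ)
  have h := hpsd.dotProduct_mulVec_nonneg y
  rwa [star_trivial, Matrix.sub_mulVec, dotProduct_sub, Algebra.algebraMap_eq_smul_one,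
    Matrix.smul_mulVec, Matrix.one_mulVec, dotProduct_smul, smul_eq_mul, sub_nonneg] at h

end Matrix

section SpectralRadius

variable {V W : Type*} [Fintype V] [DecidableEq V] [Fintype W] [DecidableEq W] {α : ℝ}
  {G : SimpleGraph V} [DecidableRel G.Adj] {H : SimpleGraph W} [DecidableRel H.Adj]

theorem alphaMatrix_mulVec_apply (y : V → ℝ) (v : V) :
    (alphaMatrix α G).mulVec y v = ∑ w, if G.Adj v w then α * y v + (1 - α) * y w else 0 := by
  rw [← Finset.sum_filter, ← G.neighborFinset_eq_filter, Finset.sum_add_distrib,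
    Finset.sum_const, G.card_neighborFinset_eq_degree, ← Finset.mul_sum]
  simp only [alphaMatrix, SimpleGraph.degMatrix, Matrix.add_mulVec, Matrix.smul_mulVec,
    Pi.add_apply, Pi.smul_apply, Matrix.mulVec_diagonal, SimpleGraph.adjMatrix_mulVec_apply,
    smul_eq_mul, nsmul_eq_mul, mul_left_comm]

theorem alphaMatrix_isHermitian : (alphaMatrix α G).IsHermitian := by
  simp [Matrix.IsHermitian, Matrix.conjTranspose_eq_transpose_of_trivial, alphaMatrix,
    SimpleGraph.degMatrix]

theorem alphaMatrix_nonneg (hα₀ : 0 ≤ α) (hα₁ : α ≤ 1) (v w : V) : 0 ≤ alphaMatrix α G v w := by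
  have : 0 ≤ 1 - α := sub_nonneg.2 hα₁
  simp only [alphaMatrix, SimpleGraph.degMatrix, Matrix.add_apply, Matrix.smul_apply,
    Matrix.diagonal_apply, SimpleGraph.adjMatrix_apply, smul_eq_mul]
  positivity

theorem alphaMatrix_reindex (e : G ≃g H) :
    (alphaMatrix α G).reindex e.toEquiv e.toEquiv = alphaMatrix α H := by
  ext v w
  have hadj : G.Adj (e.toEquiv.symm v) (e.toEquiv.symm w) ↔ H.Adj v w := e.symm.map_adj_iff
  have hdeg : G.degree (e.toEquiv.symm v) = H.degree v := e.symm.degree_eq v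
  simp [alphaMatrix, SimpleGraph.degMatrix, Matrix.diagonal_apply, hadj, hdeg]

theorem alphaSpectralRadius_eq_of_iso (e : G ≃g H) :
    alphaSpectralRadius α G = alphaSpectralRadius α H := by
  simp only [alphaSpectralRadius, Module.End.hasEigenvalue_iff_mem_spectrum,
    Matrix.spectrum_toLin', ← alphaMatrix_reindex e]
  rw [← Matrix.coe_reindexAlgEquiv ℝ ℝ, AlgEquiv.spectrum_eq]

end SpectralRadius

section AttachVertex

variable {V : Type*} {G : SimpleGraph V} {r : V}

/-- The graph obtained from `G` by joining the new vertex `none` to `r`. -/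
def attachVertex (G : SimpleGraph V) (r : V) : SimpleGraph (Option V) :=
  G.map some ⊔ .edge none (some r)

theorem attachVertex_adj_some_some {v w : V} :
    (attachVertex G r).Adj (some v) (some w) ↔ G.Adj v w := by
  simpa [attachVertex, SimpleGraph.edge_adj, SimpleGraph.map_adj'] using SimpleGraph.Adj.ne

theorem attachVertex_adj_some_none {v : V} :
    (attachVertex G r).Adj (some v) none ↔ v = r := by
  simp [attachVertex, SimpleGraph.edge_adj, SimpleGraph.map_adj']

theorem attachVertex_adj_none_some {v : V} :
    (attachVertex G r).Adj none (some v) ↔ v = r := by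
  rw [SimpleGraph.adj_comm, attachVertex_adj_some_none]

variable [Fintype V] [DecidableEq V] [DecidableRel (attachVertex G r).Adj] {α : ℝ}
  {y : V → ℝ} (b : ℝ)

theorem alphaMatrix_attachVertex_mulVec_none :
    (alphaMatrix α (attachVertex G r)).mulVec (Option.elim · b y) none =
      α * b + (1 - α) * y r := by
  simp [alphaMatrix_mulVec_apply, attachVertex_adj_none_some]

theorem alphaMatrix_attachVertex_mulVec_some [DecidableRel G.Adj] (v : V) :
    (alphaMatrix α (attachVertex G r)).mulVec (Option.elim · b y) (some v) =
      (alphaMatrix α G).mulVec y v + if v = r then α * y r + (1 - α) * b else 0 := by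
  have hv : (if v = r then α * y v + (1 - α) * b else 0) =
      if v = r then α * y r + (1 - α) * b else 0 := by
    split_ifs with h <;> simp [h]
  simp [alphaMatrix_mulVec_apply, attachVertex_adj_some_some, attachVertex_adj_some_none,
    add_comm, hv]

end AttachVertex

section RootedEigenvector

variable {V : Type*} [Fintype V] [DecidableEq V] {α t q : ℝ} {G : SimpleGraph V}
  [DecidableRel G.Adj] {r : V} {y : V → ℝ}

/-- `y` is a positive vector satisfying the equation `A_α y = t y` away from the root `r`. The
defect at `r` is written `(q + α) y(r)`: joining `r` to one further vertex `s` adds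
`α y(r) + (1 - α) y(s)` to `(A_α y)(r)`, and this repairs the equation when
`(1 - α) y(s) = q y(r)`. -/
structure IsRootedEigenvector (α t q : ℝ) (G : SimpleGraph V) [DecidableRel G.Adj] (r : V)
    (y : V → ℝ) : Prop where
  pos : ∀ v, 0 < y v
  mulVec_eq : ∀ v, (alphaMatrix α G).mulVec y v = t * y v - if v = r then (q + α) * y r else 0

theorem IsRootedEigenvector.alphaSpectralRadius_le (h : IsRootedEigenvector α t q G r y)
    (hα₀ : 0 ≤ α) (hα₁ : α ≤ 1) (hq : 0 ≤ q) : alphaSpectralRadius α G ≤ t := by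
  have : Nonempty V := ⟨r⟩
  refine hasEigenvalue_le_of_mulVec_le (alphaMatrix_nonneg hα₀ hα₁) h.pos (fun v => ?_)
    (isGreatest_alphaSpectralRadius α G).1
  rw [h.mulVec_eq]
  have hr : 0 ≤ (q + α) * y r := mul_nonneg (add_nonneg hq hα₀) (h.pos r).le
  split_ifs <;> linarith

theorem IsRootedEigenvector.sub_le_alphaSpectralRadius (h : IsRootedEigenvector α t q G r y) :
    t - (q + α) * (y r ^ 2 / (y ⬝ᵥ y)) ≤ alphaSpectralRadius α G := by
  have : Nonempty V := ⟨r⟩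
  have hy : 0 < y ⬝ᵥ y :=
    Finset.sum_pos (fun v _ => mul_pos (h.pos v) (h.pos v)) Finset.univ_nonempty
  have hrayleigh := dotProduct_mulVec_le_of_hasEigenvalue_le alphaMatrix_isHermitian
    (fun μ hμ => (isGreatest_alphaSpectralRadius α G).2 hμ) y
  have hform : y ⬝ᵥ (alphaMatrix α G).mulVec y = t * (y ⬝ᵥ y) - (q + α) * y r ^ 2 := by
    simp only [dotProduct, h.mulVec_eq, mul_sub, mul_ite, mul_zero, Finset.sum_sub_distrib,
      Finset.sum_ite_eq', Finset.mem_univ, if_true, Finset.mul_sum, mul_left_comm (y _), ← sq]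
  rw [hform] at hrayleigh
  refine le_of_mul_le_mul_right ?_ hy
  rwa [sub_mul, mul_assoc, div_mul_cancel₀ _ hy.ne']

theorem isRootedEigenvector_bot (α t : ℝ) :
    IsRootedEigenvector α t (t - α) (⊥ : SimpleGraph Unit) () (fun _ => 1) where
  pos _ := one_pos
  mulVec_eq _ := by simp [alphaMatrix_mulVec_apply]

/-- The amount by which a leaf attached to the root lowers the parameter `q` of
`IsRootedEigenvector`. -/
noncomputable def pendantWeight (α t : ℝ) : ℝ :=
  α + (1 - α) ^ 2 / (t - α)

theorem IsRootedEigenvector.attachLeaf [DecidableRel (attachVertex G r).Adj]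
    (h : IsRootedEigenvector α t q G r y) (hα : α < 1)
    (ht : α < t) :
    IsRootedEigenvector α t (q - pendantWeight α t) (attachVertex G r) (some r)
      (Option.elim · ((1 - α) * y r / (t - α)) y) where
  pos := by
    rintro (_ | v)
    exacts [div_pos (mul_pos (sub_pos.2 hα) (h.pos r)) (sub_pos.2 ht), h.pos v]
  mulVec_eq := by
    have htα : t - α ≠ 0 := (sub_pos.2 ht).ne'
    rintro (_ | v)
    · simp only [alphaMatrix_attachVertex_mulVec_none, reduceCtorEq, if_false, Option.elim_none,
        Option.elim_some]
      field_simp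
      ring
    · simp only [alphaMatrix_attachVertex_mulVec_some, h.mulVec_eq, Option.some.injEq,
        Option.elim_some, pendantWeight]
      split_ifs <;> ring

theorem IsRootedEigenvector.attachRoot [DecidableRel (attachVertex G r).Adj]
    (h : IsRootedEigenvector α t q G r y) (hα : α < 1)
    (hq : 0 < q) :
    IsRootedEigenvector α t (t - 2 * α - (1 - α) ^ 2 / q) (attachVertex G r) none
      (Option.elim · (y r * q / (1 - α)) y) where
  pos := by
    rintro (_ | v)
    exacts [div_pos (mul_pos (h.pos r) hq) (sub_pos.2 hα), h.pos v]
  mulVec_eq := by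
    have hβ : 1 - α ≠ 0 := (sub_pos.2 hα).ne'
    rintro (_ | v)
    · simp only [alphaMatrix_attachVertex_mulVec_none, if_true, Option.elim_none]
      field_simp
      ring
    · simp only [alphaMatrix_attachVertex_mulVec_some, h.mulVec_eq, reduceCtorEq, if_false,
        Option.elim_none, Option.elim_some, mul_div_cancel₀ _ hβ]
      split_ifs <;> ring

end RootedEigenvector

section SpectralRadii

open Classical in
/-- The set of the `A_α`-spectral radii of all finite nonempty graphs. -/
def alphaSpectralRadii (α : ℝ) : Set ℝ :=
  {ρ | ∃ (n : ℕ) (G : SimpleGraph (Fin (n + 1))), alphaSpectralRadius α G = ρ}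

theorem alphaSpectralRadius_mem_alphaSpectralRadii {V : Type*} [Fintype V] [DecidableEq V]
    [Nonempty V] (α : ℝ) (G : SimpleGraph V) [DecidableRel G.Adj] :
    alphaSpectralRadius α G ∈ alphaSpectralRadii α := by
  classical
  obtain ⟨n, hn⟩ := Nat.exists_eq_succ_of_ne_zero (Fintype.card_ne_zero (α := V))
  exact ⟨n, _, (alphaSpectralRadius_eq_of_iso (G.overFinIso hn)).symm⟩

theorem isAlphaLimitPoint_of_mem_closure {α x : ℝ}
    (hx : x ∈ closure (alphaSpectralRadii α ∩ Set.Ioi x)) : IsAlphaLimitPoint α x := by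
  have hglb : IsGLB (alphaSpectralRadii α ∩ Set.Ioi x) x :=
    isGLB_of_mem_closure (fun _ hy => le_of_lt hy.2) hx
  obtain ⟨u, hu, -, hlim, hmem⟩ :=
    hglb.exists_seq_strictAnti_tendsto_of_notMem (fun h => lt_irrefl x h.2)
      (closure_nonempty_iff.1 ⟨x, hx⟩)
  choose n G hG using fun k => (hmem k).1
  exact ⟨n, G, fun i j hij => by simpa only [hG] using hu.injective.ne hij,
    by simpa only [hG] using hlim⟩

theorem isAlphaLimitPoint_of_Ioi_subset_closure {α τ x : ℝ}
    (h : Set.Ioi τ ⊆ closure (alphaSpectralRadii α)) (hx : τ ≤ x) : IsAlphaLimitPoint α x := by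
  have hsub : Set.Ioi x ⊆ closure (alphaSpectralRadii α ∩ Set.Ioi x) := by
    rw [Set.inter_comm]
    exact fun y hy => isOpen_Ioi.inter_closure ⟨hy, h (hx.trans_lt hy)⟩
  refine isAlphaLimitPoint_of_mem_closure (closure_minimal hsub isClosed_closure ?_)
  rw [closure_Ioi]
  exact Set.self_mem_Ici

end SpectralRadii

section Caterpillar

/-- Existence of a rooted eigenvector of parameter `q` with value `a` at the root and squared norm
at least `S`. -/
def HasRootedEigenvector (α t q a S : ℝ) : Prop :=
  ∃ (V : Type) (_ : Fintype V) (_ : DecidableEq V) (G : SimpleGraph V) (_ : DecidableRel G.Adj)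
    (r : V) (y : V → ℝ), IsRootedEigenvector α t q G r y ∧ y r = a ∧ S ≤ y ⬝ᵥ y

variable {α t q a S : ℝ}

theorem HasRootedEigenvector.exists_mem_alphaSpectralRadii (h : HasRootedEigenvector α t q a S)
    (hα₀ : 0 ≤ α) (hα₁ : α ≤ 1) (hq : 0 ≤ q) (hS : 0 < S) :
    ∃ ρ ∈ alphaSpectralRadii α, t - (q + α) * (a ^ 2 / S) ≤ ρ ∧ ρ ≤ t := by
  obtain ⟨V, _, _, G, _, r, y, hy, rfl, hSy⟩ := h
  have : Nonempty V := ⟨r⟩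
  refine ⟨_, alphaSpectralRadius_mem_alphaSpectralRadii α G,
    le_trans ?_ hy.sub_le_alphaSpectralRadius, hy.alphaSpectralRadius_le hα₀ hα₁ hq⟩
  gcongr

theorem hasRootedEigenvector_bot (α t : ℝ) : HasRootedEigenvector α t (t - α) 1 1 :=
  ⟨Unit, inferInstance, inferInstance, ⊥, inferInstance, (), _, isRootedEigenvector_bot α t, rfl,
    by simp [dotProduct]⟩

theorem dotProduct_optionElim_self {V : Type*} [Fintype V] (b : ℝ) (y : V → ℝ) :
    (Option.elim · b y) ⬝ᵥ (Option.elim · b y) = b ^ 2 + y ⬝ᵥ y := by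
  simp [dotProduct, sq]

theorem HasRootedEigenvector.attachLeaf (h : HasRootedEigenvector α t q a S) (hα : α < 1)
    (ht : α < t) : HasRootedEigenvector α t (q - pendantWeight α t) a S := by
  classical
  obtain ⟨V, _, _, G, _, r, y, hy, rfl, hS⟩ := h
  refine ⟨Option V, inferInstance, inferInstance, _, inferInstance, _, _, hy.attachLeaf hα ht, rfl,
    hS.trans ?_⟩
  rw [dotProduct_optionElim_self]
  exact le_add_of_nonneg_left (sq_nonneg _)

theorem HasRootedEigenvector.attachLeaves (h : HasRootedEigenvector α t q a S) (hα : α < 1)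
    (ht : α < t) (n : ℕ) : HasRootedEigenvector α t (q - n * pendantWeight α t) a S := by
  induction n with
  | zero => simpa using h
  | succ n ih => simpa [add_mul, sub_sub] using ih.attachLeaf hα ht

theorem HasRootedEigenvector.attachRoot (h : HasRootedEigenvector α t q a S) (hα : α < 1)
    (hq : 0 < q) :
    HasRootedEigenvector α t (t - 2 * α - (1 - α) ^ 2 / q) (a * (q / (1 - α)))
      (S + (a * (q / (1 - α))) ^ 2) := by
  classical
  obtain ⟨V, _, _, G, _, r, y, hy, rfl, hS⟩ := h
  refine ⟨Option V, inferInstance, inferInstance, _, inferInstance, _, _, hy.attachRoot hα hq, ?_,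
    ?_⟩
  · exact mul_div_assoc _ _ _
  · rw [dotProduct_optionElim_self, mul_div_assoc, add_comm]
    gcongr

/-- The values, along the spine of a caterpillar, of a rooted eigenvector that is `1` at the first
spine vertex; `q k` is the parameter at the `k`-th spine vertex and `b = 1 - α`. -/
noncomputable def spineVector (b : ℝ) (q : ℕ → ℝ) (k : ℕ) : ℝ :=
  ∏ i ∈ Finset.range k, q i / b

theorem spineVector_zero (b : ℝ) (q : ℕ → ℝ) : spineVector b q 0 = 1 :=
  Finset.prod_range_zero _

theorem spineVector_succ (b : ℝ) (q : ℕ → ℝ) (k : ℕ) :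
    spineVector b q (k + 1) = spineVector b q k * (q k / b) :=
  Finset.prod_range_succ _ _

theorem spineVector_pos {b : ℝ} {q : ℕ → ℝ} (hb : 0 < b) (hq : ∀ k, 0 < q k) (k : ℕ) :
    0 < spineVector b q k :=
  Finset.prod_pos fun i _ => div_pos (hq i) hb

theorem hasRootedEigenvector_caterpillar {q : ℕ → ℝ} (hα : α < 1) (ht : α < t)
    (hq : ∀ k, 0 < q k) (hq_zero : ∃ n : ℕ, q 0 = t - α - n * pendantWeight α t)
    (hq_succ : ∀ k, ∃ n : ℕ,
      q (k + 1) = t - 2 * α - (1 - α) ^ 2 / q k - n * pendantWeight α t) (k : ℕ) :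
    HasRootedEigenvector α t (q k) (spineVector (1 - α) q k)
      (∑ i ∈ Finset.range (k + 1), spineVector (1 - α) q i ^ 2) := by
  induction k with
  | zero =>
    obtain ⟨n, hn⟩ := hq_zero
    simpa [hn, spineVector_zero] using (hasRootedEigenvector_bot α t).attachLeaves hα ht n
  | succ k ih =>
    obtain ⟨n, hn⟩ := hq_succ k
    rw [Finset.sum_range_succ, hn, spineVector_succ]
    exact (ih.attachRoot hα (hq k)).attachLeaves hα ht n

end Caterpillar

section GreedyOrbit

theorem exists_sub_natCast_mul_mem_Ico {m c g : ℝ} (hc : 0 < c) (hg : m ≤ g) :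
    ∃ n : ℕ, g - n * c ∈ Set.Ico m (m + c) := by
  refine ⟨⌊(g - m) / c⌋₊, ?_, ?_⟩
  · have := (le_div_iff₀ hc).1 (Nat.floor_le (div_nonneg (sub_nonneg.2 hg) hc.le))
    linarith
  · have := (div_lt_iff₀ hc).1 (Nat.lt_floor_add_one ((g - m) / c))
    linarith

variable {m M b c : ℝ}

theorem exists_greedyOrbit (hm : 0 < m) (hM : 0 ≤ M) (hb : m * M = b ^ 2) (hc : 0 < c) {g : ℝ}
    (hg : m ≤ g) :
    ∃ q : ℕ → ℝ, (∀ k, q k ∈ Set.Ico m (m + c)) ∧ (∃ n : ℕ, q 0 = g - n * c) ∧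
      ∀ k, ∃ n : ℕ, q (k + 1) = m + M - b ^ 2 / q k - n * c := by
  choose! n hn using fun g (hg : m ≤ g) => exists_sub_natCast_mul_mem_Ico hc hg
  have hle : ∀ q, m ≤ q → m ≤ m + M - b ^ 2 / q := fun q hq => by
    have : b ^ 2 / q ≤ M := by
      rw [div_le_iff₀ (hm.trans_le hq), ← hb, mul_comm]
      gcongr
    linarith
  let reduce (g : ℝ) : ℝ := g - n g * c
  let q (k : ℕ) : ℝ := k.rec (reduce g) fun _ x => reduce (m + M - b ^ 2 / x)
  have hq : ∀ k, q k ∈ Set.Ico m (m + c) := fun k => by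
    induction k with
    | zero => exact hn g hg
    | succ k ih => exact hn _ (hle _ ih.1)
  exact ⟨q, hq, ⟨_, rfl⟩, fun k => ⟨_, rfl⟩⟩

theorem sq_mul_energy_le {q : ℝ} (hm : 0 < m) (hb : m * M = b ^ 2) (hcm : c ≤ m)
    (hcM : m + c ≤ M) (hq : q ∈ Set.Ico m (m + c)) {r : ℝ}
    (hr : ∃ n : ℕ, r = m + M - b ^ 2 / q - n * c) :
    q ^ 2 * ((r - m) * (M - r)) ≤ b ^ 2 * ((q - m) * (M - q)) := by
  obtain ⟨n, rfl⟩ := hr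
  have hq₀ : 0 < q := hm.trans_le hq.1
  have hc : 0 < c := by linarith [hq.1, hq.2]
  have hmc : 0 < m + c := by linarith
  set g := m + M - b ^ 2 / q with hg
  have hconserved : q ^ 2 * ((g - m) * (M - g)) = b ^ 2 * ((q - m) * (M - q)) := by
    rw [hg, ← hb]
    field_simp
    ring
  rw [← hconserved]
  refine mul_le_mul_of_nonneg_left ?_ (sq_nonneg q)
  rcases n.eq_zero_or_pos with rfl | hn
  · simp
  have hnc : c ≤ n * c := le_mul_of_one_le_left hc.le (by exact_mod_cast hn)
  have hg_mid : 2 * g - c ≤ m + M := by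
    have hg_le : g ≤ m + M - m * M / (m + c) := by
      rw [hg, hb]
      gcongr
      exact hq.2.le
    have hmid : (m + M) / 2 - c / 2 ≤ m * M / (m + c) := by
      rw [le_div_iff₀ hmc]
      linarith [mul_nonneg (sub_nonneg.2 hcm) (sub_nonneg.2 hcM)]
    linarith
  -- `(u - m) * (M - u)` takes equal values at points symmetric about `(m + M) / 2`.
  have hgain : 0 ≤ n * c * (m + M - (2 * g - n * c)) :=
    mul_nonneg (hc.le.trans hnc) (by linarith)
  linarith

variable {q : ℕ → ℝ}

theorem spineVector_sq_mul_energy_le (hm : 0 < m) (hb₀ : b ≠ 0) (hb : m * M = b ^ 2) (hcm : c ≤ m)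
    (hcM : m + c ≤ M) (hq : ∀ k, q k ∈ Set.Ico m (m + c))
    (hq_succ : ∀ k, ∃ n : ℕ, q (k + 1) = m + M - b ^ 2 / q k - n * c) (k : ℕ) :
    spineVector b q k ^ 2 * ((q k - m) * (M - q k)) ≤ (q 0 - m) * (M - q 0) := by
  induction k with
  | zero => simp [spineVector_zero]
  | succ k ih =>
    refine le_trans ?_ ih
    rw [spineVector_succ, mul_pow, mul_assoc]
    refine mul_le_mul_of_nonneg_left ?_ (sq_nonneg _)
    rw [div_pow, div_mul_eq_mul_div, div_le_iff₀' (by positivity)]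
    exact sq_mul_energy_le hm hb hcm hcM (hq k) (hq_succ k)

theorem spineVector_le_max (hb : 0 < b) (hq : ∀ k, 0 < q k) {C : ℝ}
    (h : ∀ k, b < q k → spineVector b q (k + 1) ≤ C) (k : ℕ) : spineVector b q k ≤ max 1 C := by
  induction k with
  | zero => exact (spineVector_zero b q).trans_le (le_max_left _ _)
  | succ k ih =>
    rcases le_or_gt (q k) b with hk | hk
    · rw [spineVector_succ]
      exact (mul_le_of_le_one_right (spineVector_pos hb hq k).le ((div_le_one hb).2 hk)).trans ih
    · exact (h k hk).trans (le_max_right _ _)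

theorem exists_spineVector_le_of_le (hm : 0 < m) (hb₀ : 0 < b) (hb : m * M = b ^ 2) (hcm : c ≤ m)
    (hcM : m + c < M) (hq : ∀ k, q k ∈ Set.Ico m (m + c))
    (hq_succ : ∀ k, ∃ n : ℕ, q (k + 1) = m + M - b ^ 2 / q k - n * c) :
    ∃ C, ∀ k, spineVector b q k ≤ C := by
  have hpos : ∀ k, 0 < q k := fun k => hm.trans_le (hq k).1
  have hmb : m < b := by
    have hmM : m < M := by linarith [(hq 0).1, (hq 0).2]
    refine lt_of_pow_lt_pow_left₀ 2 hb₀.le ?_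
    rw [← hb, sq]
    gcongr
  set E := (q 0 - m) * (M - q 0)
  set w := (b - m) * (M - (m + c))
  have hw : 0 < w := mul_pos (sub_pos.2 hmb) (sub_pos.2 hcM)
  have hlarge : ∀ k, b < q k → spineVector b q k ≤ √(E / w) := fun k hk => by
    refine Real.le_sqrt_of_sq_le ((le_div_iff₀ hw).2 (le_trans ?_
      (spineVector_sq_mul_energy_le hm hb₀.ne' hb hcm hcM.le hq hq_succ k)))
    have hqk := (hq k).2.le
    exact mul_le_mul_of_nonneg_left (mul_le_mul (sub_le_sub_right hk.le m)
      (sub_le_sub_left hqk M) (sub_pos.2 hcM).le (sub_nonneg.2 (hq k).1)) (sq_nonneg _)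
  refine ⟨_, spineVector_le_max hb₀ hpos (C := √(E / w) * ((m + c) / b)) fun k hk => ?_⟩
  rw [spineVector_succ]
  gcongr
  exacts [(div_pos (hpos k) hb₀).le, hlarge k hk, (hq k).2.le]

theorem exists_spineVector_le (hm : 0 < m) (hb₀ : 0 < b) (hb : m * M = b ^ 2)
    (hc : c ≤ m ∨ m + c ≤ b) (hcM : m + c < M) (hq : ∀ k, q k ∈ Set.Ico m (m + c))
    (hq_succ : ∀ k, ∃ n : ℕ, q (k + 1) = m + M - b ^ 2 / q k - n * c) :
    ∃ C, ∀ k, spineVector b q k ≤ C := by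
  rcases hc with hcm | hcb
  · exact exists_spineVector_le_of_le hm hb₀ hb hcm hcM hq hq_succ
  · exact ⟨_, spineVector_le_max (C := 1) hb₀ (fun k => hm.trans_le (hq k).1) fun k hk =>
      absurd ((hq k).2.trans_le hcb) hk.not_gt⟩

end GreedyOrbit

theorem tendsto_div_sum_range_succ {a : ℕ → ℝ} {C : ℝ} (ha₀ : 0 < a 0) (ha : ∀ k, 0 ≤ a k)
    (hC : ∀ k, a k ≤ C) :
    Tendsto (fun k => a k / ∑ i ∈ Finset.range (k + 1), a i) atTop (𝓝 0) := by
  by_cases hs : Summable a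
  · have hpos : 0 < ∑' i, a i := hs.tsum_pos ha 0 ha₀
    rw [← zero_div (∑' i, a i)]
    exact hs.tendsto_atTop_zero.div
      (hs.hasSum.tendsto_sum_nat.comp (tendsto_add_atTop_nat 1)) hpos.ne'
  · have hsum : Tendsto (fun k => ∑ i ∈ Finset.range (k + 1), a i) atTop atTop :=
      ((not_summable_iff_tendsto_nat_atTop_of_nonneg ha).1 hs).comp (tendsto_add_atTop_nat 1)
    have hnonneg : ∀ k, 0 ≤ ∑ i ∈ Finset.range k, a i := fun k => Finset.sum_nonneg fun i _ => ha i
    exact squeeze_zero (fun k => div_nonneg (ha k) (hnonneg _))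
      (fun k => div_le_div_of_nonneg_right (hC k) (hnonneg _)) (hsum.const_div_atTop C)

section Tau

variable {α x : ℝ}

theorem F₀_eq_pendantWeight_sub (x α : ℝ) :
    F₀ x α = pendantWeight α x - (x - 2 * α + 2 * thetaPrime α x) := by
  rw [F₀, pendantWeight, ← neg_sub x α, div_neg]
  ring

theorem F₀_eq_pendantWeight_sub_sqrt (x α : ℝ) :
    F₀ x α = pendantWeight α x - √((x - 2) * (x + 2 - 4 * α)) := by
  have hdisc : (2 * α - x) ^ 2 - 4 * (1 - α) ^ 2 = (x - 2) * (x + 2 - 4 * α) := by ring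
  rw [F₀_eq_pendantWeight_sub, thetaPrime, hdisc]
  ring

theorem F₀_strictAntiOn (hα : α ≤ 1) : StrictAntiOn (fun x => F₀ x α) (Set.Ici (2 : ℝ)) := by
  intro x (hx : 2 ≤ x) y _ hxy
  have hweight : pendantWeight α y ≤ pendantWeight α x := by
    have : 0 < x - α := by linarith
    unfold pendantWeight
    gcongr
  have hsqrt : √((x - 2) * (x + 2 - 4 * α)) < √((y - 2) * (y + 2 - 4 * α)) :=
    Real.sqrt_lt_sqrt (mul_nonneg (by linarith) (by linarith))
      (mul_lt_mul'' (by linarith) (by linarith) (by linarith) (by linarith))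
  simp only [F₀_eq_pendantWeight_sub_sqrt]
  linarith

theorem pendantWeight_pos {t : ℝ} (hα₀ : 0 ≤ α) (hα₁ : α ≤ 1) (ht : 1 < t) :
    0 < pendantWeight α t := by
  have hden : 0 < t - α := by linarith
  unfold pendantWeight
  rcases hα₀.eq_or_lt with rfl | hpos
  · rw [sub_zero, zero_add]
    positivity
  · positivity

theorem F₀_two_pos (hα₀ : 0 ≤ α) (hα₁ : α ≤ 1) : 0 < F₀ 2 α := by
  rw [F₀_eq_pendantWeight_sub_sqrt, sub_self, zero_mul, Real.sqrt_zero, sub_zero]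
  exact pendantWeight_pos hα₀ hα₁ one_lt_two

theorem F₀_six_neg (hα₀ : 0 ≤ α) (hα₁ : α ≤ 1) : F₀ 6 α < 0 := by
  have hfrac : (1 - α) ^ 2 / (6 - α) < 1 := by
    rw [div_lt_one (by linarith)]
    linarith [pow_le_one₀ (n := 2) (sub_nonneg.2 hα₁) (sub_le_self 1 hα₀)]
  have hsqrt : 2 ≤ √((6 - 2) * (6 + 2 - 4 * α)) := Real.le_sqrt_of_sq_le (by linarith)
  rw [F₀_eq_pendantWeight_sub_sqrt, sub_neg]
  calc pendantWeight α 6 < 1 + 1 := add_lt_add_of_le_of_lt hα₁ hfrac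
    _ = 2 := one_add_one_eq_two
    _ ≤ _ := hsqrt

theorem exists_F₀_eq_zero (hα₀ : 0 ≤ α) (hα₁ : α ≤ 1) : ∃ x, 2 < x ∧ F₀ x α = 0 := by
  have hcont : ContinuousOn (fun x => F₀ x α) (Set.Icc 2 6) := by
    simp only [F₀_eq_pendantWeight_sub_sqrt, pendantWeight]
    have hden : ∀ x ∈ Set.Icc (2 : ℝ) 6, x - α ≠ 0 := fun x hx => by linarith [hx.1]
    fun_prop (disch := assumption)
  obtain ⟨x, hx, hx₀⟩ := intermediate_value_Ioo' (by norm_num) hcont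
    ⟨F₀_six_neg hα₀ hα₁, F₀_two_pos hα₀ hα₁⟩
  exact ⟨x, hx.1, hx₀⟩

theorem setOf_F₀_eq_zero (hα₀ : 0 ≤ α) (hα₁ : α ≤ 1) :
    {x : ℝ | 2 < x ∧ F₀ x α = 0} = {tau₀ α} := by
  obtain ⟨x, hx, hx₀⟩ := exists_F₀_eq_zero hα₀ hα₁
  have hunique : {x : ℝ | 2 < x ∧ F₀ x α = 0} = {x} :=
    Set.eq_singleton_iff_unique_mem.2 ⟨⟨hx, hx₀⟩, fun y hy =>
      (F₀_strictAntiOn hα₁).injOn hy.1.le hx.le (hy.2.trans hx₀.symm)⟩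
  rw [tau₀, hunique, csInf_singleton]

theorem two_lt_and_F₀_neg_of_tau₀_lt (hα₀ : 0 ≤ α) (hα₁ : α ≤ 1) (hx : tau₀ α < x) :
    2 < x ∧ F₀ x α < 0 := by
  obtain ⟨hτ, hτ₀⟩ : 2 < tau₀ α ∧ F₀ (tau₀ α) α = 0 := (setOf_F₀_eq_zero hα₀ hα₁).symm.subset rfl
  exact ⟨hτ.trans hx, hτ₀ ▸ F₀_strictAntiOn hα₁ hτ.le (hτ.trans hx).le hx⟩

theorem thetaPrime_mul (hα : α ≤ 1) (hx : 2 ≤ x) :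
    thetaPrime α x * (2 * α - x - thetaPrime α x) = (1 - α) ^ 2 := by
  have hdisc : 0 ≤ (2 * α - x) ^ 2 - 4 * (1 - α) ^ 2 := by
    linarith [mul_nonneg (show 0 ≤ x - 2 by linarith) (show 0 ≤ x + 2 - 4 * α by linarith)]
  calc thetaPrime α x * (2 * α - x - thetaPrime α x)
      = ((2 * α - x) ^ 2 - √((2 * α - x) ^ 2 - 4 * (1 - α) ^ 2) ^ 2) / 4 := by
        unfold thetaPrime
        ring
    _ = (1 - α) ^ 2 := by
        rw [Real.sq_sqrt hdisc]
        ring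

theorem thetaPrime_neg (hα : α < 1) (hx : 2 ≤ x) : thetaPrime α x < 0 := by
  have hsqrt : √((2 * α - x) ^ 2 - 4 * (1 - α) ^ 2) < x - 2 * α := by
    rw [Real.sqrt_lt' (by linarith)]
    linarith [pow_pos (sub_pos.2 hα) 2, neg_sq (x - 2 * α), neg_sub x (2 * α)]
  unfold thetaPrime
  linarith

end Tau

section Density

variable {α t : ℝ}

theorem pendantWeight_le_or_add_pendantWeight_le {m M : ℝ} (hα₀ : 0 ≤ α) (hα₁ : α < 1)
    (hα : 4 / 5 ≤ (1 - α) ^ 2) (hm : 0 < m) (hsum : m + M = t - 2 * α)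
    (hprod : m * M = (1 - α) ^ 2) :
    pendantWeight α t ≤ m ∨ m + pendantWeight α t ≤ 1 - α := by
  have hβ : 0 < 1 - α := sub_pos.2 hα₁
  have hM : 0 < M := pos_of_mul_pos_right (hprod ▸ pow_pos hβ 2) hm.le
  have hden : t - α = α + (m + M) := by linarith
  have hden₀ : 0 < α + (m + M) := by linarith
  have hα_small : α ^ 2 + 2 * α * (1 - α) ≤ (1 - α) ^ 2 / 4 := by linarith
  rw [pendantWeight, hden]
  rcases le_total ((1 - α) / 2) m with hmβ | hmβ
  · left
    have hMβ : M ≤ 2 * (1 - α) :=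
      le_of_mul_le_mul_left (by linarith [mul_le_mul_of_nonneg_right hmβ hβ.le]) hm
    suffices (1 - α) ^ 2 / (α + (m + M)) ≤ m - α by linarith
    rw [div_le_iff₀ hden₀]
    have hm_sq : ((1 - α) / 2) ^ 2 ≤ m ^ 2 := by gcongr
    have hαM : α * M ≤ α * (2 * (1 - α)) := by gcongr
    linarith [hα_small]
  · right
    have hMβ : 2 * (1 - α) ≤ M := by
      refine le_of_mul_le_mul_left ?_ (half_pos hβ)
      linarith [mul_le_mul_of_nonneg_right hmβ hM.le]
    have hsum_ge : 5 / 2 * (1 - α) ≤ m + M := by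
      refine le_of_mul_le_mul_left ?_ hM
      linarith [mul_nonneg (sub_nonneg.2 hMβ) (show 0 ≤ M - (1 - α) / 2 by linarith)]
    suffices (1 - α) ^ 2 / (α + (m + M)) ≤ (1 - α) / 2 - α by linarith
    have hαβ : α ≤ (1 - α) / 2 := by
      refine le_of_mul_le_mul_left ?_ hβ
      linarith [sq_nonneg α, sq_nonneg (1 - α)]
    rw [div_le_iff₀ hden₀]
    linarith [mul_le_mul_of_nonneg_left hsum_ge (sub_nonneg.2 hαβ)]

theorem mem_closure_alphaSpectralRadii_of_bounded {q x : ℕ → ℝ} {C Q : ℝ} (hα₀ : 0 ≤ α)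
    (hα₁ : α ≤ 1) (hq : ∀ k, q k ∈ Set.Icc 0 Q) (hx : ∀ k, x k ∈ Set.Ioc 0 C)
    (h : ∀ k, HasRootedEigenvector α t (q k) (x k) (∑ i ∈ Finset.range (k + 1), x i ^ 2)) :
    t ∈ closure (alphaSpectralRadii α) := by
  have hsum : ∀ k, 0 < ∑ i ∈ Finset.range (k + 1), x i ^ 2 := fun k =>
    Finset.sum_pos (fun i _ => pow_pos (hx i).1 2) Finset.nonempty_range_add_one
  choose ρ hρ hρ_ge hρ_le using fun k =>
    (h k).exists_mem_alphaSpectralRadii hα₀ hα₁ (hq k).1 (hsum k)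
  have hratio : Tendsto (fun k => x k ^ 2 / ∑ i ∈ Finset.range (k + 1), x i ^ 2) atTop (𝓝 0) :=
    tendsto_div_sum_range_succ (pow_pos (hx 0).1 2) (fun k => sq_nonneg _)
      fun k => pow_le_pow_left₀ (hx k).1.le (hx k).2 2
  have hlower : Tendsto
      (fun k => t - (Q + α) * (x k ^ 2 / ∑ i ∈ Finset.range (k + 1), x i ^ 2)) atTop (𝓝 t) := by
    simpa using (hratio.const_mul (Q + α)).const_sub t
  refine mem_closure_of_tendsto (tendsto_of_tendsto_of_tendsto_of_le_of_le hlower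
    tendsto_const_nhds (fun k => le_trans ?_ (hρ_ge k)) hρ_le) (.of_forall hρ)
  gcongr
  exact (hq k).2

theorem mem_closure_alphaSpectralRadii (hα₀ : 0 ≤ α) (hα₁ : α < 1) (hα : 4 / 5 ≤ (1 - α) ^ 2)
    (ht : 2 < t) (hF : F₀ t α < 0) : t ∈ closure (alphaSpectralRadii α) := by
  set m := -thetaPrime α t with hm_def
  set M := t - 2 * α - m with hM_def
  have hβ : 0 < 1 - α := sub_pos.2 hα₁
  have hm : 0 < m := neg_pos.2 (thetaPrime_neg hα₁ ht.le)
  have hsum : m + M = t - 2 * α := add_sub_cancel m _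
  have hprod : m * M = (1 - α) ^ 2 := by
    rw [← thetaPrime_mul hα₁.le ht.le, hM_def, hm_def]
    ring
  have hc : 0 < pendantWeight α t := pendantWeight_pos hα₀ hα₁.le (by linarith)
  have hcM : m + pendantWeight α t < M := by
    rw [F₀_eq_pendantWeight_sub] at hF
    linarith
  obtain ⟨q, hq, hq_zero, hq_succ⟩ := exists_greedyOrbit hm (show 0 ≤ M by linarith) hprod hc
    (show m ≤ t - α by linarith)
  obtain ⟨C, hC⟩ := exists_spineVector_le hm hβ hprod
    (pendantWeight_le_or_add_pendantWeight_le hα₀ hα₁ hα hm hsum hprod) hcM hq hq_succ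
  rw [hsum] at hq_succ
  have hq_pos : ∀ k, 0 < q k := fun k => hm.trans_le (hq k).1
  exact mem_closure_alphaSpectralRadii_of_bounded hα₀ hα₁.le
    (fun k => ⟨(hq_pos k).le, (hq k).2.le⟩) (fun k => ⟨spineVector_pos hβ hq_pos k, hC k⟩)
    (hasRootedEigenvector_caterpillar hα₁ (by linarith) hq_pos hq_zero hq_succ)

end Density

theorem corollary5p2 (α : ℝ) (hα₀ : 0 ≤ α) (hα₁ : α < 1 - 2 * √5 / 5) :
    {x : ℝ | 2 < x ∧ F₀ x α = 0} = {tau₀ α} ∧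
      ∀ x : ℝ, tau₀ α ≤ x → IsAlphaLimitPoint α x := by
  have hα_lt : α < 1 := hα₁.trans_le (sub_le_self 1 (by positivity))
  have hα : 4 / 5 ≤ (1 - α) ^ 2 := by
    calc (4 / 5 : ℝ) = (2 * √5 / 5) ^ 2 := by rw [div_pow, mul_pow, Real.sq_sqrt] <;> norm_num
      _ ≤ (1 - α) ^ 2 := by gcongr; linarith
  refine ⟨setOf_F₀_eq_zero hα₀ hα_lt.le, fun x => isAlphaLimitPoint_of_Ioi_subset_closure ?_⟩
  intro t ht
  obtain ⟨ht₂, hF⟩ := two_lt_and_F₀_neg_of_tau₀_lt hα₀ hα_lt.le ht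
  exact mem_closure_alphaSpectralRadii hα₀ hα_lt hα ht₂ hF
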